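/- **Theorem 3.2.** *Model.* Let $\mathcal I$ (routes) and $\mathcal J$ (queues) be finite sets. Route $i$ visits the queues $j^i_1,\dots,j^i_{k_i}$ in this order ($k_i\ge 1$, repetitions allowed), and $\zeta_{ji}=\#\{k: j^i_k=j\}$. Documents arrive on route $i$ as independent Poisson processes of rates $\nu_i\ge 0$, with independent sizes distributed as $X_i\in\{1,2,\dots\}$, $\mathbb E X_i=\mu_i^{-1}<\infty$; put $\rho_i=\nu_i/\mu_i$. A packet has a class $(i,k,y)$ (route, stage, residual document size). A document of size $x$ on route $i$ enters queue $j^i_1$ as class $(i,1,x)$. On completing service, class $(i,k,y)$ with $k<k_i$ joins queue $j^i_{k+1}$ as class $(i,k+1,y)$; class $(i,k_i,y)$ with $y>1$ joins queue $j^i_1$ as class $(i,1,y-1)$; class $(i,k_i,1)$ leaves the network. Service requirements are independent and exponential with mean $1$. If queue $j$ holds $m\ge1$ packets, it serves at total rate $\phi_j(m)>0$, a proportion $\gamma_j(l,m)\ge0$ of which goes to the packet in position $l\in\{1,\dots,m\}$, $\sum_{l=1}^m\gamma_j(l,m)=1$. A packet whose arrival brings the number of packets in queue $j$ to $m$ joins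 at position $l\in\{1,\dots,m\}$ with probability $\delta_j(l,m)\ge0$, $\sum_{l=1}^m\delta_j(l,m)=1$; the other packets keep their order. The explicit state $q=(q_j)_{j\in\mathcal J}$, $q_j=(c_j(1),\dots,c_j(m_j))$, records the class $c_j(l)=(i_j(l),k_j(l),y_j(l))$ of the packet in each position $l$ of each queue $j$. Let $\mathcal Q$ be the set of all such states ($m_j\ge 0$, and stage $k_j(l)$ of route $i_j(l)$ is at queue $j$). The explicit state is a continuous-time Markov chain on $\mathcal Q$. *Claim.* Suppose that $$B_j:=\sum_{m=0}^{\infty}\ \prod_{l=1}^{m}\frac{\sum_{i\in\mathcal I}\zeta_{ji}\rho_i}{\phi_j(l)}<\infty\qquad\text{for every } j\in\mathcal J .$$ Then the explicit state has exactly one stationary distribution (a probability distribution $\pi$ on $\mathcal Q$ with $\pi P_t=\pi$ for all $t\ge0$, where $P_t$ is the transition function of the chain), namely $$\pi(q)=\prod_{j\in\mathcal J}\frac1{B_j}\prod_{l=1}^{m_j}\frac{\nu_{i_j(l)}\,\mathbb P\big(X_{i_j(l)}\ge y_j(l)\big)}{\phi_j(l)},\qquad q\in\mathcal Q .$$ 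-/

import Mathlib

open scoped NNReal ENNReal

noncomputable section

/-! ### Continuous-time Markov chains on a discrete state space -/

namespace JumpChain

variable {S : Type*}

/-- Total rate at which the chain with transition rates `r` leaves (jumps from) `x`. -/
def exitRate (r : S → S → ℝ≥0∞) (x : S) : ℝ≥0∞ := ∑' y, r x y

/-- Probability that an exponential holding time in `x` exceeds `t` (for a finite exit rate). -/
def holdProb (r : S → S → ℝ≥0∞) (x : S) (t : ℝ) : ℝ≥0∞ :=
  ENNReal.ofReal (Real.exp (-((exitRate r x).toReal * t)))

open Classical in
/-- `transUpTo r n t x y` is the probability that the chain started in `x` is in `y` at time `t`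
and has made at most `n` jumps by then. Either no jump occurred, or one decomposes over
the time `s` of the last jump before `t`, a jump from some `z` to `y`. -/
def transUpTo (r : S → S → ℝ≥0∞) : ℕ → ℝ → S → S → ℝ≥0∞
  | 0, t, x, y => if x = y then holdProb r x t else 0
  | n + 1, t, x, y =>
      (if x = y then holdProb r x t else 0) +
        ∫⁻ s in Set.Icc 0 t, (∑' z, transUpTo r n s x z * r z y) * holdProb r y (t - s)

/-- The (minimal, or Feller) transition function `P_t(x, y)` of the chain with rates `r`. -/
def trans (r : S → S → ℝ≥0∞) (t : ℝ) (x y : S) : ℝ≥0∞ := ⨆ n, transUpTo r n t x y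

/-- `p` is a stationary distribution of the chain with rates `r`:
a probability distribution with `p P_t = p` for all `t ≥ 0`. -/
def IsStationary (r : S → S → ℝ≥0∞) (p : S → ℝ≥0∞) : Prop :=
  ∑' x, p x = 1 ∧ ∀ t : ℝ, 0 ≤ t → ∀ y, ∑' x, p x * trans r t x y = p y

end JumpChain

/-! ### Multi-class queueing networks with spinning -/

/-- Data of a multi-class queueing network with spinning, with routes `I` and queues `J`.
Stages of routes and positions in queues are numbered from `0`. -/
structure MQNwS (I J : Type*) where
  /-- number of stages of a route -/
  len : I → ℕ
  len_pos : ∀ i, 0 < len i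
  /-- the queue visited at each stage of a route (repetitions allowed) -/
  queue : (i : I) → Fin (len i) → J
  /-- Poisson arrival rate of documents on a route -/
  arrRate : I → ℝ≥0
  /-- law of the document size `X_i` -/
  size : I → PMF ℕ+
  mean_lt_top : ∀ i, ∑' x : ℕ+, ((x : ℕ) : ℝ≥0∞) * size i x < ⊤
  /-- `φ j m` is the total service rate of queue `j` when it holds `m` packets -/
  φ : J → ℕ → ℝ≥0
  φ_pos : ∀ j m, 0 < m → 0 < φ j m
  /-- `γ j m l` is the proportion of service given to position `l` among `m` packets -/
  γ : J → (m : ℕ) → Fin m → ℝ≥0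
  γ_sum : ∀ j m, 0 < m → ∑ l, γ j m l = 1
  /-- `δ j m l` is the probability that a packet that brings the number of packets in queue `j`
  up to `m` joins at position `l` -/
  δ : J → (m : ℕ) → Fin m → ℝ≥0
  δ_sum : ∀ j m, 0 < m → ∑ l, δ j m l = 1

namespace MQNwS

variable {I J : Type*} (N : MQNwS I J)

/-- A packet class `(i, k, y)` that can be present in queue `j`: route, stage and residual
document size, where stage `k` of route `i` is at queue `j`. -/
@[ext]
structure PacketClass (j : J) where
  route : I
  stage : Fin (N.len route)
  residual : ℕ+
  queue_eq : N.queue route stage = j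

/-- Explicit states: for every queue, the list of the classes of the packets in
its successive positions. -/
abbrev State : Type _ := (j : J) → List (N.PacketClass j)

/-- A class of packet together with the queue where it is. -/
abbrev Located : Type _ := Σ j : J, N.PacketClass j

/-- Class `(i, 1, x)`, at the first queue of route `i`. -/
def entry (i : I) (x : ℕ+) : N.Located := ⟨_, ⟨i, ⟨0, N.len_pos i⟩, x, rfl⟩⟩

/-- What a packet becomes, and where it goes, on completing its service: the next stage of the
route; or from the last stage the first stage with residual size reduced by one; or, if the
residual size is one at the last stage, it departs (`none`). -/
def next {j : J} (c : N.PacketClass j) : Option N.Located :=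
  if h : (c.stage : ℕ) + 1 < N.len c.route then
    some ⟨_, ⟨c.route, ⟨c.stage + 1, h⟩, c.residual, rfl⟩⟩
  else if 1 < c.residual then some (N.entry c.route (c.residual - 1))
  else none

open Classical in
/-- Insert a packet at position `l` of its queue; the packets from `l` on move back by one. -/
def insertAt (q : N.State) (p : N.Located) (l : ℕ) : N.State :=
  Function.update q p.1 ((q p.1).insertIdx l p.2)

open Classical in
/-- Remove the packet at position `l` of queue `j`; the packets behind move up by one. -/
def removeAt (q : N.State) (j : J) (l : ℕ) : N.State :=
  Function.update q j ((q j).eraseIdx l)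

open Classical in
/-- Probability that the state becomes `q'` when a packet `p` joins its queue in state `q`. -/
def joinProb (q : N.State) (p : N.Located) (q' : N.State) : ℝ≥0∞ :=
  ∑ l : Fin ((q p.1).length + 1),
    if q' = N.insertAt q p l then (N.δ p.1 ((q p.1).length + 1) l : ℝ≥0∞) else 0

open Classical in
/-- Probability that the state becomes `q'` when the packet in position `l` of queue `j`
completes its service in state `q`. -/
def moveProb (q : N.State) (j : J) (l : Fin (q j).length) (q' : N.State) : ℝ≥0∞ :=
  match N.next ((q j).get l) with
  | none => if q' = N.removeAt q j l then 1 else 0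
  | some p => N.joinProb (N.removeAt q j l) p q'

/-- Transition rates of the explicit state: document arrivals and service completions. -/
def rate [Fintype I] [Fintype J] (q q' : N.State) : ℝ≥0∞ :=
  ∑ i, ∑' x : ℕ+, N.arrRate i * N.size i x * N.joinProb q (N.entry i x) q' +
  ∑ j, ∑ l : Fin (q j).length,
    N.φ j (q j).length * N.γ j (q j).length l * N.moveProb q j l q'

/-- `P(X_i ≥ y)`. -/
def tail (i : I) (y : ℕ+) : ℝ≥0∞ := ∑' x : Set.Ici y, N.size i x

/-- Mean document size `1 / μ_i = E X_i`. -/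
def meanSize (i : I) : ℝ≥0∞ := ∑' x : ℕ+, ((x : ℕ) : ℝ≥0∞) * N.size i x

/-- Traffic intensity `ρ_i = ν_i / μ_i`. -/
def load (i : I) : ℝ≥0∞ := N.arrRate i * N.meanSize i

/-- `ζ_{ji}`, the number of stages of route `i` that are at queue `j`. -/
def visits (j : J) (i : I) : ℕ := Nat.card {k : Fin (N.len i) // N.queue i k = j}

/-- The constant `B_j`, a sum over the number `m ≥ 0` of packets in queue `j`. -/
def B [Fintype I] (j : J) : ℝ≥0∞ :=
  ∑' m : ℕ, ∏ l ∈ Finset.Icc 1 m, (∑ i, N.visits j i * N.load i) / N.φ j l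

/-- The product-form distribution. The packet at (zero-based) position `l` of the
list contributes the factor with `φ j (l + 1)`. -/
def productForm [Fintype I] [Fintype J] (q : N.State) : ℝ≥0∞ :=
  ∏ j, ((N.B j)⁻¹ * ∏ l : Fin (q j).length,
    N.arrRate ((q j).get l).route * N.tail ((q j).get l).route ((q j).get l).residual
      / N.φ j ((l : ℕ) + 1))

end MQNwS

end

/-!
The proof has two independent parts.

*Markov chains.* For a measure `p` satisfying the balance equations, the last-jump recursion gives
`p P_t ≤ p`. Integrated, the recursion says that for `f_t = p P_t` the mass in `y` at time `t` plus
the flow out of `y` up to `t` is the initial mass plus the flow into `y`. If the mean jump rate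
`∑ p(x) exitRate(x)` is finite, then so is the total flow; summing over `y` it cancels, so `p P_t` has the
same total mass as `p` and hence `p P_t = p` (`JumpChain.isStationary_of_balance`). Without such an
argument the balance equations would not suffice, because the minimal chain might explode.
Uniqueness holds as soon as some state is accessible from every state
(`JumpChain.IsStationary.unique`).

*The network.* Taking a packet out of a state `q` leaves a state `R`, and the flow of services of
the packet is `π(q) φ_j(m_j) = π(R) ν_i P(X_i ≥ y)`, whatever its position
(`MQNwS.productForm_insertAt`). Hence the proportions `γ` sum out, then the traffic equations
(`MQNwS.traffic_equation`) turn the flow of packets that finish a service or arrive into the flow of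
packets that join, and finally the probabilities `δ` sum out when the packet is put back. This
yields global balance (`MQNwS.productForm_balance`). The same computation bounds the mean jump rate
by the sum of the `ν_i` and of all class rates. The empty state is accessible from every state since
every nonempty queue serves some packet at a positive rate, and each service reduces the total number
of services that the packets present still need.
-/

noncomputable section

/-! ### Sums and integrals of extended nonnegative functions -/

/-- Monotone convergence for infinite sums. -/
theorem ENNReal.tsum_iSup_of_monotone {α : Type*} {f : ℕ → α → ℝ≥0∞} (hf : Monotone f) :
    ∑' a, ⨆ n, f n a = ⨆ n, ∑' a, f n a := by
  let _ : MeasurableSpace α := ⊤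
  simp_rw [← MeasureTheory.lintegral_count]
  exact MeasureTheory.lintegral_iSup (fun n => measurable_from_top) hf

theorem measurable_lintegral_Icc_conv {f h : ℝ → ℝ≥0∞} (hf : Measurable f) (hh : Measurable h) :
    Measurable fun t : ℝ => ∫⁻ s in Set.Icc 0 t, f s * h (t - s) := by
  have hset : MeasurableSet {x : ℝ × ℝ | x.2 ∈ Set.Icc 0 x.1} :=
    (measurableSet_le measurable_const measurable_snd).inter
      (measurableSet_le measurable_snd measurable_fst)
  have hm : Measurable ({x : ℝ × ℝ | x.2 ∈ Set.Icc 0 x.1}.indicator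
      fun x => f x.2 * h (x.1 - x.2)) :=
    ((hf.comp measurable_snd).mul (hh.comp (measurable_fst.sub measurable_snd))).indicator hset
  have key := hm.lintegral_prod_right' (ν := MeasureTheory.volume)
  convert key using 2 with t
  rw [← MeasureTheory.lintegral_indicator measurableSet_Icc]
  rfl

/-- The exponential density of rate `c` on `[a, b]`, together with the survival probability,
has total mass one. -/
theorem ofReal_exp_add_lintegral_exp {c a b : ℝ} (hc : 0 ≤ c) (hab : a ≤ b) :
    ENNReal.ofReal (Real.exp (-(c * (b - a)))) +
      ENNReal.ofReal c * ∫⁻ s in Set.Icc a b, ENNReal.ofReal (Real.exp (-(c * (s - a)))) = 1 := by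
  have hcont : Continuous fun s : ℝ => c * Real.exp (-(c * (s - a))) := by fun_prop
  have hint : ∫ s in a..b, c * Real.exp (-(c * (s - a))) = 1 - Real.exp (-(c * (b - a))) := by
    rw [intervalIntegral.integral_eq_sub_of_hasDerivAt
      (f := fun s => -Real.exp (-(c * (s - a))))]
    · simp only [sub_self, mul_zero, neg_zero, Real.exp_zero]; ring
    · intro s _
      have h1 : HasDerivAt (fun s => -(c * (s - a))) (-(c * 1)) s :=
        (((hasDerivAt_id s).sub_const a).const_mul c).neg
      exact h1.exp.neg.congr_deriv (by ring)
    · exact hcont.intervalIntegrable _ _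
  rw [← MeasureTheory.lintegral_const_mul _ (by fun_prop)]
  simp_rw [← ENNReal.ofReal_mul hc]
  rw [← MeasureTheory.ofReal_integral_eq_lintegral_ofReal (hcont.integrableOn_Icc)
      (Filter.Eventually.of_forall fun s => by positivity),
    MeasureTheory.integral_Icc_eq_integral_Ioc, ← intervalIntegral.integral_of_le hab, hint,
    ← ENNReal.ofReal_add (by positivity)]
  · simp
  · have : Real.exp (-(c * (b - a))) ≤ 1 :=
      Real.exp_le_one_iff.2 (neg_nonpos.2 (mul_nonneg hc (sub_nonneg.2 hab)))
    linarith

/-- The convolution `g` of `f` with `s ↦ exp (-c s)` solves `g' = f - c g` with `g 0 = 0`,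
in integrated form. -/
theorem conv_exp_add_lintegral {f : ℝ → ℝ≥0∞} (hf : Measurable f) {c : ℝ} (hc : 0 ≤ c) (t : ℝ) :
    (∫⁻ u in Set.Icc 0 t, f u * ENNReal.ofReal (Real.exp (-(c * (t - u))))) +
      ENNReal.ofReal c * ∫⁻ s in Set.Icc 0 t, ∫⁻ u in Set.Icc 0 s,
        f u * ENNReal.ofReal (Real.exp (-(c * (s - u)))) = ∫⁻ u in Set.Icc 0 t, f u := by
  have hset : MeasurableSet {x : ℝ × ℝ | x.2 ≤ x.1} :=
    measurableSet_le measurable_snd measurable_fst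
  have hm : Measurable ({x : ℝ × ℝ | x.2 ≤ x.1}.indicator
      fun x => f x.2 * ENNReal.ofReal (Real.exp (-(c * (x.1 - x.2))))) :=
    ((hf.comp measurable_snd).mul (by fun_prop)).indicator hset
  have h1 : ∫⁻ s in Set.Icc 0 t, ∫⁻ u in Set.Icc 0 s,
        f u * ENNReal.ofReal (Real.exp (-(c * (s - u)))) =
      ∫⁻ s in Set.Icc 0 t, ∫⁻ u in Set.Icc 0 t, ({x : ℝ × ℝ | x.2 ≤ x.1}.indicator
        fun x => f x.2 * ENNReal.ofReal (Real.exp (-(c * (x.1 - x.2))))) (s, u) := by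
    refine MeasureTheory.setLIntegral_congr_fun measurableSet_Icc fun s hs => ?_
    rw [← MeasureTheory.lintegral_indicator measurableSet_Icc,
      ← MeasureTheory.lintegral_indicator measurableSet_Icc]
    congr 1 with u
    simp only [Set.indicator, Set.mem_Icc, Set.mem_ofPred_eq]
    have := hs.2
    split_ifs <;> first | rfl | (exfalso; grind)
  have h2 : ∀ u ∈ Set.Icc 0 t, ∫⁻ s in Set.Icc 0 t, ({x : ℝ × ℝ | x.2 ≤ x.1}.indicator
        fun x => f x.2 * ENNReal.ofReal (Real.exp (-(c * (x.1 - x.2))))) (s, u) =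
      f u * ∫⁻ s in Set.Icc u t, ENNReal.ofReal (Real.exp (-(c * (s - u)))) := by
    intro u hu
    rw [← MeasureTheory.lintegral_const_mul _ (by fun_prop),
      ← MeasureTheory.lintegral_indicator measurableSet_Icc,
      ← MeasureTheory.lintegral_indicator measurableSet_Icc]
    congr 1 with s
    simp only [Set.indicator, Set.mem_Icc, Set.mem_ofPred_eq]
    have := hu.1
    split_ifs <;> first | rfl | (exfalso; grind)
  have h3 := MeasureTheory.lintegral_lintegral_swap
    (μ := MeasureTheory.volume.restrict (Set.Icc 0 t))
    (ν := MeasureTheory.volume.restrict (Set.Icc 0 t))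
    (f := fun s u => ({x : ℝ × ℝ | x.2 ≤ x.1}.indicator
      fun x => f x.2 * ENNReal.ofReal (Real.exp (-(c * (x.1 - x.2))))) (s, u)) hm.aemeasurable
  rw [h1, h3,
    MeasureTheory.setLIntegral_congr_fun measurableSet_Icc h2,
    ← MeasureTheory.lintegral_const_mul' _ _ ENNReal.ofReal_ne_top,
    ← MeasureTheory.lintegral_add_left
      (f := fun u => f u * ENNReal.ofReal (Real.exp (-(c * (t - u))))) (by fun_prop)]
  refine MeasureTheory.setLIntegral_congr_fun measurableSet_Icc fun u hu => ?_
  rw [mul_left_comm, ← mul_add, ofReal_exp_add_lintegral_exp hc hu.2, mul_one]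

/-- Variation of constants: `g' = h - c g` with `g 0 = a`, in integrated form. -/
theorem add_lintegral_of_eq_exp_conv {g h : ℝ → ℝ≥0∞} (hh : Measurable h) {a c : ℝ≥0∞} (hc : c ≠ ⊤)
    (hg : ∀ t, g t = a * ENNReal.ofReal (Real.exp (-(c.toReal * t))) +
      ∫⁻ s in Set.Icc 0 t, h s * ENNReal.ofReal (Real.exp (-(c.toReal * (t - s)))))
    {t : ℝ} (ht : 0 ≤ t) :
    g t + c * ∫⁻ s in Set.Icc 0 t, g s = a + ∫⁻ s in Set.Icc 0 t, h s := by
  have h1 := conv_exp_add_lintegral hh (c := c.toReal) ENNReal.toReal_nonneg t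
  have h2 := ofReal_exp_add_lintegral_exp (c := c.toReal) ENNReal.toReal_nonneg ht
  simp only [sub_zero] at h2
  rw [ENNReal.ofReal_toReal hc] at h1 h2
  simp only [hg]
  rw [MeasureTheory.lintegral_add_left (by fun_prop),
    MeasureTheory.lintegral_const_mul _ (by fun_prop), ← h1]
  nth_rewrite 3 [← mul_one a]
  rw [← h2]
  ring

theorem lintegral_Icc_sub_left (g : ℝ → ℝ≥0∞) (t : ℝ) :
    ∫⁻ s in Set.Icc 0 t, g (t - s) = ∫⁻ s in Set.Icc 0 t, g s := by
  rw [← MeasureTheory.lintegral_indicator measurableSet_Icc,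
    ← MeasureTheory.lintegral_indicator measurableSet_Icc,
    ← MeasureTheory.lintegral_sub_left_eq_self ((Set.Icc 0 t).indicator g) t]
  congr 1 with s
  simp only [Set.indicator, Set.mem_Icc]
  split_ifs <;> first | rfl | (exfalso; grind)

/-! ### The minimal transition function -/

namespace JumpChain

variable {S : Type*} {r : S → S → ℝ≥0∞}

theorem holdProb_pos (r : S → S → ℝ≥0∞) (x : S) (t : ℝ) : 0 < holdProb r x t :=
  ENNReal.ofReal_pos.2 (Real.exp_pos _)

theorem measurable_holdProb (r : S → S → ℝ≥0∞) (x : S) : Measurable (holdProb r x) := by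
  unfold holdProb; fun_prop

theorem transUpTo_mono_succ (r : S → S → ℝ≥0∞) (n : ℕ) :
    ∀ t x y, transUpTo r n t x y ≤ transUpTo r (n + 1) t x y := by
  induction n with
  | zero => intro t x y; simp only [transUpTo]; exact le_self_add
  | succ n ih =>
    intro t x y
    rw [transUpTo, transUpTo]
    gcongr
    exact ih _ _ _

theorem transUpTo_mono (r : S → S → ℝ≥0∞) (t : ℝ) (x y : S) :
    Monotone fun n => transUpTo r n t x y :=
  monotone_nat_of_le_succ fun n => transUpTo_mono_succ r n t x y

section Countable

variable [Countable S]

theorem measurable_transUpTo (r : S → S → ℝ≥0∞) (n : ℕ) :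
    ∀ x y, Measurable fun t => transUpTo r n t x y := by
  induction n with
  | zero =>
    intro x y
    simp only [transUpTo]
    split_ifs
    · exact measurable_holdProb r x
    · exact measurable_const
  | succ n ih =>
    intro x y
    simp only [transUpTo]
    refine Measurable.add ?_ (measurable_lintegral_Icc_conv
      (Measurable.tsum fun z => (ih x z).mul_const _) (measurable_holdProb r y))
    split_ifs
    · exact measurable_holdProb r x
    · exact measurable_const

theorem measurable_trans (r : S → S → ℝ≥0∞) (x y : S) : Measurable fun t => trans r t x y :=
  Measurable.iSup fun n => measurable_transUpTo r n x y

/-- Forward equation for the chain with initial measure `p`, decomposing over the last jump. -/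
theorem tsum_mul_transUpTo_succ (r : S → S → ℝ≥0∞) (p : S → ℝ≥0∞) (n : ℕ) (t : ℝ) (y : S) :
    ∑' x, p x * transUpTo r (n + 1) t x y = p y * holdProb r y t +
      ∫⁻ s in Set.Icc 0 t,
        (∑' z, (∑' x, p x * transUpTo r n s x z) * r z y) * holdProb r y (t - s) := by
  classical
  have hmeas : ∀ x, Measurable fun s => (∑' z, transUpTo r n s x z * r z y) *
      holdProb r y (t - s) := fun x =>
    (Measurable.tsum fun z => (measurable_transUpTo r n x z).mul_const _).mul
      ((measurable_holdProb r y).comp (by fun_prop))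
  simp only [transUpTo, mul_add]
  rw [ENNReal.tsum_add]
  congr 1
  · rw [tsum_eq_single y]
    · simp
    · intro x hx; simp [hx]
  · simp_rw [← MeasureTheory.lintegral_const_mul _ (hmeas _)]
    rw [← MeasureTheory.lintegral_tsum fun x => ((hmeas x).const_mul _).aemeasurable]
    congr 1 with s
    simp_rw [← ENNReal.tsum_mul_right, ← ENNReal.tsum_mul_left]
    rw [ENNReal.tsum_comm]
    simp_rw [mul_assoc]

/-- Forward equation for the minimal transition function. -/
theorem tsum_mul_trans_eq (r : S → S → ℝ≥0∞) (p : S → ℝ≥0∞) (t : ℝ) (y : S) :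
    ∑' x, p x * trans r t x y = p y * holdProb r y t +
      ∫⁻ s in Set.Icc 0 t,
        (∑' z, (∑' x, p x * trans r s x z) * r z y) * holdProb r y (t - s) := by
  have hsup : ∀ s z, ∑' x, p x * trans r s x z = ⨆ n, ∑' x, p x * transUpTo r n s x z := by
    intro s z
    simp_rw [trans, ENNReal.mul_iSup]
    exact ENNReal.tsum_iSup_of_monotone fun m n h x => mul_le_mul_right (transUpTo_mono r s x z h) _
  have hmono : ∀ s z, Monotone fun n => ∑' x, p x * transUpTo r n s x z := fun s z m n h =>
    ENNReal.tsum_le_tsum fun x => mul_le_mul_right (transUpTo_mono r s x z h) _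
  have hmeas : ∀ n, Measurable fun s => (∑' z, (∑' x, p x * transUpTo r n s x z) * r z y) *
      holdProb r y (t - s) := fun n =>
    (Measurable.tsum fun z => (Measurable.tsum fun x =>
      (measurable_transUpTo r n x z).const_mul _).mul_const _).mul
      ((measurable_holdProb r y).comp (by fun_prop))
  have hint : ∫⁻ s in Set.Icc 0 t,
        (∑' z, (∑' x, p x * trans r s x z) * r z y) * holdProb r y (t - s) =
      ⨆ n, ∫⁻ s in Set.Icc 0 t,
        (∑' z, (∑' x, p x * transUpTo r n s x z) * r z y) * holdProb r y (t - s) := by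
    rw [← MeasureTheory.lintegral_iSup hmeas]
    · congr 1 with s
      simp_rw [hsup, ENNReal.iSup_mul]
      rw [ENNReal.tsum_iSup_of_monotone, ENNReal.iSup_mul]
      exact fun m n h z => mul_le_mul_left (hmono s z h) _
    · exact fun m n h s => mul_le_mul_left
        (ENNReal.tsum_le_tsum fun z => mul_le_mul_left (hmono s z h) _) _
  rw [hint, hsup, ENNReal.add_iSup, ← (hmono t y).iSup_nat_add 1]
  exact iSup_congr fun n => tsum_mul_transUpTo_succ r p n t y

/-- Forward equation in integrated form: mass in `y` at time `t` plus flow out of `y` up to time `t`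
equals the initial mass plus the flow into `y`. -/
theorem tsum_mul_trans_add (r : S → S → ℝ≥0∞) (p : S → ℝ≥0∞) {t : ℝ} (ht : 0 ≤ t) {y : S}
    (hy : exitRate r y ≠ ⊤) :
    ∑' x, p x * trans r t x y +
        exitRate r y * ∫⁻ s in Set.Icc 0 t, ∑' x, p x * trans r s x y =
      p y + ∫⁻ s in Set.Icc 0 t, ∑' z, (∑' x, p x * trans r s x z) * r z y := by
  have hmeas : Measurable fun s => ∑' z, (∑' x, p x * trans r s x z) * r z y :=
    Measurable.tsum fun z => (Measurable.tsum fun x =>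
      (measurable_trans r x z).const_mul _).mul_const _
  exact add_lintegral_of_eq_exp_conv hmeas hy (fun t => tsum_mul_trans_eq r p t y) ht

theorem tsum_mul_transUpTo_add (r : S → S → ℝ≥0∞) (p : S → ℝ≥0∞) (n : ℕ) {t : ℝ} (ht : 0 ≤ t)
    {y : S} (hy : exitRate r y ≠ ⊤) :
    ∑' x, p x * transUpTo r (n + 1) t x y +
        exitRate r y * ∫⁻ s in Set.Icc 0 t, ∑' x, p x * transUpTo r (n + 1) s x y =
      p y + ∫⁻ s in Set.Icc 0 t, ∑' z, (∑' x, p x * transUpTo r n s x z) * r z y := by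
  have hmeas : Measurable fun s => ∑' z, (∑' x, p x * transUpTo r n s x z) * r z y :=
    Measurable.tsum fun z => (Measurable.tsum fun x =>
      (measurable_transUpTo r n x z).const_mul _).mul_const _
  exact add_lintegral_of_eq_exp_conv hmeas hy (fun t => tsum_mul_transUpTo_succ r p n t y) ht

/-- The expected number of jumps up to time `t` among the first `n + 1` ones is finite, and
the total mass after at most `n` jumps is at most one. -/
theorem tsum_transUpTo_le_one (hr : ∀ x, exitRate r x ≠ ⊤) (x : S) (n : ℕ) {t : ℝ} (ht : 0 ≤ t) :
    ∫⁻ s in Set.Icc 0 t, ∑' y, transUpTo r n s x y * exitRate r y ≠ ⊤ ∧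
      ∑' y, transUpTo r n t x y ≤ 1 := by
  classical
  have hhold : ∀ s, 0 ≤ s → holdProb r x s ≤ 1 := fun s hs =>
    ENNReal.ofReal_le_one.2 (Real.exp_le_one_iff.2
      (neg_nonpos.2 (mul_nonneg ENNReal.toReal_nonneg hs)))
  have hdirac : ∀ (g : S → ℝ≥0∞), ∑' z, (if z = x then 1 else 0) * g z = g x := fun g => by
    rw [tsum_eq_single x] <;> simp +contextual
  have hfm : ∀ n y, Measurable fun s => transUpTo r n s x y := fun n y =>
    measurable_transUpTo r n x y
  induction n with
  | zero =>
    have h0 : ∀ (s : ℝ) (g : S → ℝ≥0∞),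
        ∑' y, transUpTo r 0 s x y * g y = holdProb r x s * g x := fun s g => by
      rw [tsum_eq_single x]
      · simp [transUpTo]
      · intro y hy; simp [transUpTo, hy.symm]
    constructor
    · refine ne_top_of_le_ne_top (b := ∫⁻ s in Set.Icc 0 t, exitRate r x) ?_
        (MeasureTheory.setLIntegral_mono' measurableSet_Icc fun s hs => ?_)
      · rw [MeasureTheory.setLIntegral_const, Real.volume_Icc]
        exact ENNReal.mul_ne_top (hr x) ENNReal.ofReal_ne_top
      · rw [h0]; exact mul_le_of_le_one_left' (hhold s hs.1)
    · simpa using (h0 t fun _ => 1).trans_le (by simpa using hhold t ht)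
  | succ n ih =>
    have h := tsum_congr (L := SummationFilter.unconditional S) fun y =>
      tsum_mul_transUpTo_add r (fun z => if z = x then 1 else 0) n ht (hr y)
    simp only [hdirac] at h
    rw [ENNReal.tsum_add, ENNReal.tsum_add] at h
    have hout : ∑' y, exitRate r y * ∫⁻ s in Set.Icc 0 t, transUpTo r (n + 1) s x y =
        ∫⁻ s in Set.Icc 0 t, ∑' y, transUpTo r (n + 1) s x y * exitRate r y := by
      rw [MeasureTheory.lintegral_tsum fun y => ((hfm _ y).mul_const _).aemeasurable]
      congr 1 with y
      rw [MeasureTheory.lintegral_mul_const _ (hfm _ y), mul_comm]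
    have hin : ∑' y, ∫⁻ s in Set.Icc 0 t, ∑' z, transUpTo r n s x z * r z y =
        ∫⁻ s in Set.Icc 0 t, ∑' y, transUpTo r n s x y * exitRate r y := by
      rw [← MeasureTheory.lintegral_tsum fun y =>
        (Measurable.tsum fun z => (hfm n z).mul_const _).aemeasurable]
      congr 1 with s
      rw [ENNReal.tsum_comm]
      simp_rw [ENNReal.tsum_mul_left]
      rfl
    rw [hout, hin, tsum_ite_eq] at h
    have hle : ∫⁻ s in Set.Icc 0 t, ∑' y, transUpTo r n s x y * exitRate r y ≤
        ∫⁻ s in Set.Icc 0 t, ∑' y, transUpTo r (n + 1) s x y * exitRate r y :=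
      MeasureTheory.lintegral_mono fun s => ENNReal.tsum_le_tsum fun y =>
        mul_le_mul_left (transUpTo_mono_succ r n s x y) _
    refine ⟨ne_top_of_le_ne_top (ENNReal.add_ne_top.2 ⟨ENNReal.one_ne_top, ih.1⟩)
      (le_add_self.trans h.le), ?_⟩
    refine (ENNReal.add_le_add_iff_right ih.1).1 ?_
    calc _ ≤ _ := add_le_add_right hle _
      _ = _ := h

/-- The minimal transition function is substochastic. -/
theorem tsum_trans_le_one (hr : ∀ x, exitRate r x ≠ ⊤) (x : S) {t : ℝ} (ht : 0 ≤ t) :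
    ∑' y, trans r t x y ≤ 1 := by
  simp_rw [trans]
  rw [ENNReal.tsum_iSup_of_monotone fun m n h y => transUpTo_mono r t x y h]
  exact iSup_le fun n => (tsum_transUpTo_le_one hr x n ht).2

/-- A measure satisfying the balance equations is subinvariant. -/
theorem tsum_mul_trans_le {p : S → ℝ≥0∞} (hr : ∀ x, exitRate r x ≠ ⊤)
    (hbal : ∀ y, ∑' x, p x * r x y = p y * exitRate r y) {t : ℝ} (ht : 0 ≤ t) (y : S) :
    ∑' x, p x * trans r t x y ≤ p y := by
  have hn : ∀ n, ∀ t, 0 ≤ t → ∀ y, ∑' x, p x * transUpTo r n t x y ≤ p y := by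
    intro n
    have hhold : ∀ t, 0 ≤ t → ∀ y, p y * holdProb r y t ≤ p y := fun t ht y =>
      mul_le_of_le_one_right' (ENNReal.ofReal_le_one.2 (Real.exp_le_one_iff.2
        (neg_nonpos.2 (mul_nonneg ENNReal.toReal_nonneg ht))))
    induction n with
    | zero =>
      intro t ht y
      rw [tsum_eq_single y]
      · simpa [transUpTo] using hhold t ht y
      · intro x hx; simp [transUpTo, hx]
    | succ n ih =>
      intro t ht y
      have h2 : exitRate r y * ∫⁻ s in Set.Icc 0 t, holdProb r y (t - s) ≤
          1 - holdProb r y t := by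
        have h := ofReal_exp_add_lintegral_exp (c := (exitRate r y).toReal)
          ENNReal.toReal_nonneg ht
        simp only [sub_zero] at h
        rw [ENNReal.ofReal_toReal (hr y)] at h
        rw [lintegral_Icc_sub_left]
        refine ENNReal.le_sub_of_add_le_left ENNReal.ofReal_ne_top h.le
      rw [tsum_mul_transUpTo_succ]
      calc p y * holdProb r y t + ∫⁻ s in Set.Icc 0 t,
            (∑' z, (∑' x, p x * transUpTo r n s x z) * r z y) * holdProb r y (t - s)
          ≤ p y * holdProb r y t + ∫⁻ s in Set.Icc 0 t,
            (p y * exitRate r y) * holdProb r y (t - s) := by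
              gcongr 1
              refine MeasureTheory.setLIntegral_mono' measurableSet_Icc fun s hs => ?_
              rw [← hbal]
              gcongr
              exact ih s hs.1 _
        _ ≤ p y * (holdProb r y t + (1 - holdProb r y t)) := by
              rw [MeasureTheory.lintegral_const_mul (f := fun s => holdProb r y (t - s)) _
                ((measurable_holdProb r y).comp (by fun_prop)), mul_assoc, ← mul_add]
              gcongr
        _ = p y := by
          rw [add_tsub_cancel_of_le, mul_one]
          exact ENNReal.ofReal_le_one.2 (Real.exp_le_one_iff.2
            (neg_nonpos.2 (mul_nonneg ENNReal.toReal_nonneg ht)))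
  simp_rw [trans, ENNReal.mul_iSup]
  rw [ENNReal.tsum_iSup_of_monotone (f := fun n x => p x * transUpTo r n t x y)
    fun m n h x => mul_le_mul_right (transUpTo_mono r t x y h) _]
  exact iSup_le fun n => hn n t ht y

/-- A probability distribution that satisfies the balance equations is stationary if its mean jump
rate is finite: this rules out explosion from `p`-almost every state. -/
theorem isStationary_of_balance {p : S → ℝ≥0∞} (hr : ∀ x, exitRate r x ≠ ⊤)
    (hbal : ∀ y, ∑' x, p x * r x y = p y * exitRate r y) (hp : ∑' x, p x = 1)
    (hfin : ∑' x, p x * exitRate r x ≠ ⊤) : IsStationary r p := by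
  refine ⟨hp, fun t ht => ?_⟩
  set f : ℝ → S → ℝ≥0∞ := fun s y => ∑' x, p x * trans r s x y with hf
  have hfm : ∀ y, Measurable fun s => f s y := fun y =>
    Measurable.tsum fun x => (measurable_trans r x y).const_mul _
  have hle : ∀ s, 0 ≤ s → ∀ y, f s y ≤ p y := fun s hs y => tsum_mul_trans_le hr hbal hs y
  have hflow : ∑' y, exitRate r y * ∫⁻ s in Set.Icc 0 t, f s y =
      ∫⁻ s in Set.Icc 0 t, ∑' y, f s y * exitRate r y := by
    rw [MeasureTheory.lintegral_tsum fun y => ((hfm y).mul_const _).aemeasurable]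
    congr 1 with y
    rw [MeasureTheory.lintegral_mul_const _ (hfm y), mul_comm]
  have hin : ∑' y, ∫⁻ s in Set.Icc 0 t, ∑' z, f s z * r z y =
      ∫⁻ s in Set.Icc 0 t, ∑' y, f s y * exitRate r y := by
    rw [← MeasureTheory.lintegral_tsum fun y =>
      (Measurable.tsum fun z => (hfm z).mul_const _).aemeasurable]
    congr 1 with s
    rw [ENNReal.tsum_comm]
    simp_rw [ENNReal.tsum_mul_left]
    rfl
  have hflow_fin : ∫⁻ s in Set.Icc 0 t, ∑' y, f s y * exitRate r y ≠ ⊤ := by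
    refine ne_top_of_le_ne_top (b := ∫⁻ s in Set.Icc 0 t, ∑' y, p y * exitRate r y) ?_
      (MeasureTheory.setLIntegral_mono' measurableSet_Icc fun s hs =>
        ENNReal.tsum_le_tsum fun y => mul_le_mul_left (hle s hs.1 y) _)
    rw [MeasureTheory.setLIntegral_const, Real.volume_Icc]
    exact ENNReal.mul_ne_top hfin ENNReal.ofReal_ne_top
  -- Sum the integrated forward equation over `y`: the total flows in and out are equal and finite.
  have hsum : ∑' y, f t y = 1 := by
    have h := tsum_congr (L := SummationFilter.unconditional S) fun y => tsum_mul_trans_add r p ht (hr y)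
    rw [ENNReal.tsum_add, ENNReal.tsum_add, hp] at h
    change ∑' y, f t y + ∑' y, exitRate r y * ∫⁻ s in Set.Icc 0 t, f s y =
      1 + ∑' y, ∫⁻ s in Set.Icc 0 t, ∑' z, f s z * r z y at h
    rw [hflow, hin] at h
    exact (ENNReal.add_left_inj hflow_fin).1 h
  intro y
  by_contra hne
  have := ENNReal.tsum_lt_tsum (by rw [hsum]; exact ENNReal.one_ne_top) (hle t ht)
    (lt_of_le_of_ne (hle t ht y) hne)
  rw [hsum, hp] at this
  exact lt_irrefl _ this

/-! ### Uniqueness of the stationary distribution -/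

theorem transUpTo_pos_of_relation {x z y : S} {n : ℕ} (h : ∀ t, 0 < t → 0 < transUpTo r n t x z)
    (hzy : 0 < r z y) {t : ℝ} (ht : 0 < t) : 0 < transUpTo r (n + 1) t x y := by
  rw [transUpTo]
  refine lt_of_lt_of_le ?_ le_add_self
  have hm : Measurable fun s => (∑' z, transUpTo r n s x z * r z y) * holdProb r y (t - s) :=
    (Measurable.tsum fun z => (measurable_transUpTo r n x z).mul_const _).mul
      ((measurable_holdProb r y).comp (by fun_prop))
  rw [MeasureTheory.setLIntegral_pos_iff hm]
  refine lt_of_lt_of_le ?_ (MeasureTheory.measure_mono (s := Set.Ioc 0 t) ?_)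
  · simpa using ht
  · intro s hs
    refine ⟨?_, hs.1.le, hs.2⟩
    refine (ENNReal.mul_pos (ne_of_gt ?_) (holdProb_pos r y _).ne').ne'
    exact lt_of_lt_of_le (ENNReal.mul_pos (h s hs.1).ne' hzy.ne')
      (ENNReal.le_tsum (f := fun z => transUpTo r n s x z * r z y) z)

/-- If `y` can be reached from `x` by jumps of positive rate, then `P_t(x, y) > 0` for `t > 0`. -/
theorem trans_pos_of_reflTransGen {x y : S}
    (h : Relation.ReflTransGen (fun a b => 0 < r a b) x y) {t : ℝ} (ht : 0 < t) :
    0 < trans r t x y := by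
  have : ∃ n, ∀ t, 0 < t → 0 < transUpTo r n t x y := by
    induction h with
    | refl => exact ⟨0, fun t _ => by simpa [transUpTo] using holdProb_pos r x t⟩
    | tail _ hzy ih =>
      obtain ⟨n, hn⟩ := ih
      exact ⟨n + 1, fun t ht => transUpTo_pos_of_relation hn hzy ht⟩
  obtain ⟨n, hn⟩ := this
  exact lt_of_lt_of_le (hn t ht) (le_iSup (fun n => transUpTo r n t x y) n)

/-- From almost every state for a stationary distribution, the chain does not explode. -/
theorem IsStationary.mul_row_eq {p : S → ℝ≥0∞} (hp : IsStationary r p)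
    (hr : ∀ x, exitRate r x ≠ ⊤) {t : ℝ} (ht : 0 ≤ t) (x : S) :
    p x * ∑' y, trans r t x y = p x := by
  by_contra hne
  have hle : ∀ x, p x * ∑' y, trans r t x y ≤ p x := fun x =>
    mul_le_of_le_one_right' (tsum_trans_le_one hr x ht)
  have hsum : ∑' x, p x * ∑' y, trans r t x y = 1 := by
    simp_rw [← ENNReal.tsum_mul_left]
    rw [ENNReal.tsum_comm, ← hp.1]
    exact tsum_congr fun y => hp.2 t ht y
  have := ENNReal.tsum_lt_tsum (by rw [hsum]; exact ENNReal.one_ne_top) hle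
    (lt_of_le_of_ne (hle x) hne)
  rw [hsum, hp.1] at this
  exact lt_irrefl _ this

/-- A chain with a state that is accessible from every state has at most one stationary
distribution. The minimum of two stationary distributions `p` and `p'` is invariant, so the
differences from it are invariant measures with disjoint supports; each of them charges the
accessible state unless it vanishes. -/
theorem IsStationary.unique {p p' : S → ℝ≥0∞} (hp : IsStationary r p) (hp' : IsStationary r p')
    (hr : ∀ x, exitRate r x ≠ ⊤) {o : S} {t : ℝ} (ht : 0 ≤ t) (ho : ∀ x, 0 < trans r t x o) :
    p = p' := by
  have hfin : ∀ {p}, IsStationary r p → ∀ x, p x ≠ ⊤ := fun hp x =>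
    ne_top_of_le_ne_top (by rw [hp.1]; exact ENNReal.one_ne_top) (ENNReal.le_tsum x)
  set m : S → ℝ≥0∞ := fun x => min (p x) (p' x) with hm
  have hmp : ∀ x, m x ≤ p x := fun x => min_le_left _ _
  have hmp' : ∀ x, m x ≤ p' x := fun x => min_le_right _ _
  have hmfin : ∑' x, m x ≠ ⊤ :=
    ne_top_of_le_ne_top (by rw [hp.1]; exact ENNReal.one_ne_top) (ENNReal.tsum_le_tsum hmp)
  have hmtop : ∀ x, m x ≠ ⊤ := fun x => ne_top_of_le_ne_top (hfin hp x) (hmp x)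
  have hrow : ∀ x, m x * ∑' y, trans r t x y = m x := by
    intro x
    by_cases hx : p x = 0
    · have : m x = 0 := le_antisymm ((hmp x).trans hx.le) bot_le
      rw [this, zero_mul]
    · have h1 := hp.mul_row_eq hr ht x
      have : ∑' y, trans r t x y = 1 :=
        (ENNReal.mul_right_inj hx (hfin hp x)).1 (h1.trans (mul_one _).symm)
      rw [this, mul_one]
  have hle : ∀ y, ∑' x, m x * trans r t x y ≤ m y := by
    refine fun y => le_min ?_ ?_
    · rw [← hp.2 t ht y]
      exact ENNReal.tsum_le_tsum fun x => mul_le_mul_left (hmp x) _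
    · rw [← hp'.2 t ht y]
      exact ENNReal.tsum_le_tsum fun x => mul_le_mul_left (hmp' x) _
  have hmass : ∑' y, ∑' x, m x * trans r t x y = ∑' x, m x := by
    rw [ENNReal.tsum_comm]
    simp_rw [ENNReal.tsum_mul_left, hrow]
  have hinv : ∀ y, ∑' x, m x * trans r t x y = m y := by
    intro y
    by_contra hne
    have := ENNReal.tsum_lt_tsum (by rw [hmass]; exact hmfin) hle (lt_of_le_of_ne (hle y) hne)
    rw [hmass] at this
    exact lt_irrefl _ this
  -- A stationary distribution that is not below `m` exceeds `m` in the accessible state.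
  have hpos : ∀ {p}, IsStationary r p → (∀ x, m x ≤ p x) → ∀ x, m x < p x → m o < p o := by
    intro p hp hmp x hx
    rw [← hinv o, ← hp.2 t ht o]
    refine ENNReal.tsum_lt_tsum (i := x) (by rw [hinv]; exact hmtop o)
      (fun x => mul_le_mul_left (hmp x) _) ?_
    refine (ENNReal.mul_lt_mul_iff_left (ho x).ne' ?_).2 hx
    exact ne_top_of_le_ne_top ENNReal.one_ne_top
      ((ENNReal.le_tsum o).trans (tsum_trans_le_one hr x ht))
  have heq : ∀ {p p'}, IsStationary r p → IsStationary r p' → (∀ x, p x ≤ p' x) → p = p' := by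
    intro p p' hp hp' h
    by_contra hne
    obtain ⟨x, hx⟩ := Function.ne_iff.1 hne
    have := ENNReal.tsum_lt_tsum (by rw [hp.1]; exact ENNReal.one_ne_top) h
      (lt_of_le_of_ne (h x) hx)
    rw [hp.1, hp'.1] at this
    exact lt_irrefl _ this
  by_cases h : ∃ x, m x < p x
  · by_cases h' : ∃ x, m x < p' x
    · obtain ⟨x, hx⟩ := h
      obtain ⟨x', hx'⟩ := h'
      have h1 := hpos hp hmp x hx
      have h2 := hpos hp' hmp' x' hx'
      exact absurd (lt_min h1 h2) (lt_irrefl _)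
    · push Not at h'
      exact (heq hp' hp fun x => (h' x).trans (hmp x)).symm
  · push Not at h
    exact heq hp hp' fun x => (h x).trans (hmp' x)

end Countable

end JumpChain

/-! ### Sums over dependent functions, lists and positive integers -/

theorem ENNReal.tsum_pi_prod {ι : Type*} [Fintype ι] {β : ι → Type*} (f : ∀ i, β i → ℝ≥0∞) :
    ∑' v : ∀ i, β i, ∏ i, f i (v i) = ∏ i, ∑' b, f i b := by
  revert β
  refine Fintype.induction_empty_option (P := fun ι [Fintype ι] => ∀ {β : ι → Type _}
    (f : ∀ i, β i → ℝ≥0∞), ∑' v : ∀ i, β i, ∏ i, f i (v i) = ∏ i, ∑' b, f i b) ?_ ?_ ?_ ι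
  · intro α α' _ e ih β f
    let _ := Fintype.ofEquiv α' e.symm
    rw [← (Equiv.piCongrLeft β e).tsum_eq, ← e.prod_comp]
    simp_rw [← e.prod_comp, Equiv.piCongrLeft_apply_apply]
    exact ih fun a => f (e a)
  · intro β f
    simp
  · intro α _ ih β f
    rw [← (Equiv.piOptionEquivProd (β := β)).symm.tsum_eq, ENNReal.tsum_prod', Fintype.prod_option]
    simp_rw [Fintype.prod_option]
    rw [← ih fun a => f (some a), ← ENNReal.tsum_mul_right]
    simp_rw [← ENNReal.tsum_mul_left]
    rfl

/-- Sum over all lists of a weight that is a product over entries times a function of the length. -/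
theorem ENNReal.tsum_list {α : Type*} (w : α → ℝ≥0∞) (u : ℕ → ℝ≥0∞) :
    ∑' L : List α, (L.map w).prod * u L.length = ∑' m, (∑' a, w a) ^ m * u m := by
  rw [← List.equivSigmaTuple.symm.tsum_eq, ENNReal.tsum_sigma']
  congr 1 with m
  simp only [List.equivSigmaTuple, Equiv.coe_fn_symm_mk, List.map_ofFn, List.prod_ofFn,
    List.length_ofFn, Function.comp]
  rw [ENNReal.tsum_mul_right, ENNReal.tsum_pi_prod (fun _ : Fin m => w)]
  simp

theorem ENNReal.tsum_pnat_eq_add (g : ℕ+ → ℝ≥0∞) : ∑' y, g y = g 1 + ∑' y, g (y + 1) := by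
  have h := fun g : ℕ+ → ℝ≥0∞ => Equiv.pnatEquivNat.symm.tsum_eq g
  rw [← h, ← h fun y => g (y + 1), tsum_eq_zero_add' ENNReal.summable]
  rfl

/-- A sum over all stages `f 0, …, f (K - 1)`, and the sum over the successors of all stages, where
`c` replaces the successor of the last one, share all terms but `f 0` and `c`. -/
theorem Fin.exists_sum_shift {M : Type*} [AddCommMonoid M] {K : ℕ} (hK : 0 < K) (f : Fin K → M)
    (c : M) : ∃ s, ∑ k : Fin K, (if h : (k : ℕ) + 1 < K then f ⟨k + 1, h⟩ else c) = c + s ∧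
      ∑ k, f k = f ⟨0, hK⟩ + s := by
  obtain ⟨n, rfl⟩ : ∃ n, K = n + 1 := ⟨K - 1, by omega⟩
  refine ⟨∑ k : Fin n, f k.succ, ?_, Fin.sum_univ_succ f⟩
  rw [Fin.sum_univ_castSucc, add_comm]
  congr 1
  · simp
  · refine Finset.sum_congr rfl fun k _ => ?_
    rw [dif_pos (by simp)]
    rfl

namespace MQNwS

variable {I J : Type*} (N : MQNwS I J)

/-! ### Document sizes -/

theorem tail_eq_tsum_ite (i : I) (y : ℕ+) :
    N.tail i y = ∑' x, if y ≤ x then N.size i x else 0 := by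
  rw [tail, tsum_subtype (Set.Ici y) (N.size i)]
  simp only [Set.indicator, Set.mem_Ici]

theorem tail_one (i : I) : N.tail i 1 = 1 := by
  rw [tail_eq_tsum_ite, ← (N.size i).tsum_coe]
  simp

theorem tail_eq_size_add (i : I) (y : ℕ+) : N.tail i y = N.size i y + N.tail i (y + 1) := by
  simp_rw [tail_eq_tsum_ite]
  rw [← tsum_ite_eq y (fun x => N.size i x), ← ENNReal.tsum_add]
  congr 1 with x
  rcases lt_trichotomy x y with h | rfl | h
  · have h2 : ¬ y + 1 ≤ x := fun h' => absurd (PNat.add_one_le_iff.1 h') h.not_gt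
    simp [h.ne, h.not_ge, h2]
  · have h2 : ¬ x + 1 ≤ x := fun h' => lt_irrefl _ (PNat.add_one_le_iff.1 h')
    simp [h2]
  · have h2 : y + 1 ≤ x := PNat.add_one_le_iff.2 h
    simp [h.ne', h.le, h2]

theorem tsum_tail (i : I) : ∑' y, N.tail i y = N.meanSize i := by
  simp_rw [tail_eq_tsum_ite]
  rw [ENNReal.tsum_comm, meanSize]
  congr 1 with x
  rw [tsum_eq_sum (s := Finset.Icc 1 x)]
  · rw [Finset.sum_congr rfl (g := fun _ => N.size i x)
      fun y hy => if_pos (Finset.mem_Icc.1 hy).2]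
    simp
  · intro y hy
    simp at hy
    simp [hy]

/-! ### Traffic equations -/

/-- Class `(i, k, y)`, at the queue of stage `k` of route `i`. -/
def located (i : I) (k : Fin (N.len i)) (y : ℕ+) : N.Located := ⟨N.queue i k, ⟨i, k, y, rfl⟩⟩

/-- The rate at which packets turn into class `c = (i, k, y)`, namely `ν_i P(X_i ≥ y)`. -/
def classRate {j : J} (c : N.PacketClass j) : ℝ≥0∞ := N.arrRate c.route * N.tail c.route c.residual

/-- Triples `(i, k, y)` correspond to located classes. -/
def locatedEquiv : (Σ i, ℕ+ × Fin (N.len i)) ≃ N.Located where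
  toFun a := N.located a.1 a.2.2 a.2.1
  invFun p := ⟨p.2.route, p.2.residual, p.2.stage⟩
  left_inv _ := rfl
  right_inv := by rintro ⟨_, i, k, y, rfl⟩; rfl

theorem tsum_located [Fintype I] (f : N.Located → ℝ≥0∞) :
    ∑' p, f p = ∑ i, ∑' y, ∑ k, f (N.located i k y) := by
  rw [← N.locatedEquiv.tsum_eq, ENNReal.tsum_sigma', tsum_fintype]
  refine Finset.sum_congr rfl fun i _ => ?_
  rw [ENNReal.tsum_prod']
  simp_rw [tsum_fintype]
  rfl

/-- The total rate of all classes; it also is the mean service rate of the network. -/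
theorem tsum_classRate_located [Fintype I] :
    ∑' p : N.Located, N.classRate p.2 = ∑ i, N.len i * N.load i := by
  rw [tsum_located]
  refine Finset.sum_congr rfl fun i _ => ?_
  simp only [classRate, located, Finset.sum_const, Finset.card_univ, Fintype.card_fin,
    nsmul_eq_mul]
  rw [ENNReal.tsum_mul_left, ENNReal.tsum_mul_left, tsum_tail, load]

theorem load_ne_top (i : I) : N.load i ≠ ⊤ :=
  ENNReal.mul_ne_top ENNReal.coe_ne_top (N.mean_lt_top i).ne

/-- The packet classes that can be present in queue `j`, as triples. -/
def packetClassEquiv (j : J) : (Σ i, {k // N.queue i k = j} × ℕ+) ≃ N.PacketClass j where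
  toFun a := ⟨a.1, a.2.1.1, a.2.2, a.2.1.2⟩
  invFun c := ⟨c.route, ⟨c.stage, c.queue_eq⟩, c.residual⟩
  left_inv _ := rfl
  right_inv _ := rfl

/-- The total rate of the classes in queue `j` is the load `∑ i, ζ_{ji} ρ_i` in `B_j`. -/
theorem tsum_classRate [Fintype I] (j : J) :
    ∑' c : N.PacketClass j, N.classRate c = ∑ i, N.visits j i * N.load i := by
  classical
  rw [← (N.packetClassEquiv j).tsum_eq, ENNReal.tsum_sigma', tsum_fintype]
  refine Finset.sum_congr rfl fun i _ => ?_
  rw [ENNReal.tsum_prod', tsum_fintype]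
  simp only [classRate, packetClassEquiv, Equiv.coe_fn_mk]
  simp_rw [ENNReal.tsum_mul_left, tsum_tail]
  simp [visits, load, Nat.card_eq_fintype_card]

instance [Countable I] (j : J) : Countable (N.PacketClass j) :=
  (N.packetClassEquiv j).symm.injective.countable

theorem next_located (i : I) (k : Fin (N.len i)) (y : ℕ+) :
    N.next (N.located i k y).2 = if h : (k : ℕ) + 1 < N.len i then
      some (N.located i ⟨k + 1, h⟩ y)
      else if 1 < y then some (N.entry i (y - 1)) else none := rfl

/-- Traffic equations in weak form: the flows into the classes, from outside and by completions of
services, are the `classRate`s, and documents depart at their arrival rate. -/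
theorem traffic_equation [Fintype I] (F : Option N.Located → ℝ≥0∞) :
    ∑ i, ∑' x : ℕ+, N.arrRate i * N.size i x * F (some (N.entry i x)) +
        ∑' p : N.Located, N.classRate p.2 * F (N.next p.2) =
      (∑ i, (N.arrRate i : ℝ≥0∞)) * F none + ∑' p : N.Located, N.classRate p.2 * F (some p) := by
  rw [tsum_located, tsum_located, Finset.sum_mul, ← Finset.sum_add_distrib,
    ← Finset.sum_add_distrib]
  refine Finset.sum_congr rfl fun i _ => ?_
  have hs := fun y : ℕ+ => Fin.exists_sum_shift (N.len_pos i) (fun k => F (some (N.located i k y)))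
    (F (if 1 < y then some (N.entry i (y - 1)) else none))
  choose s hs1 hs2 using hs
  have h1 : ∀ y, ∑ k, N.classRate (N.located i k y).2 * F (N.next (N.located i k y).2) =
      N.arrRate i * N.tail i y *
        (F (if 1 < y then some (N.entry i (y - 1)) else none) + s y) := fun y => by
    rw [← hs1, Finset.mul_sum]
    refine Finset.sum_congr rfl fun k _ => ?_
    rw [next_located, apply_dite F]
    rfl
  have h2 : ∀ y, ∑ k, N.classRate (N.located i k y).2 * F (some (N.located i k y)) =
      N.arrRate i * N.tail i y * (F (some (N.entry i y)) + s y) := fun y => by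
    have := hs2 y
    change _ = F (some (N.entry i y)) + s y at this
    rw [← this, Finset.mul_sum]
    rfl
  simp_rw [h1, h2, mul_add]
  rw [ENNReal.tsum_add, ENNReal.tsum_add, ← add_assoc, ← add_assoc]
  congr 1
  -- A packet at the last stage with residual size `y + 1` becomes one of size `y` at the entry, where
  -- the arrivals complete `P(X ≥ y + 1) + P(X = y) = P(X ≥ y)`; residual size `1` departs.
  rw [ENNReal.tsum_pnat_eq_add (fun y => N.arrRate i * N.tail i y *
    F (if 1 < y then some (N.entry i (y - 1)) else none))]
  have h3 : ∀ y : ℕ+, (1 < y + 1) := fun y => Subtype.coe_lt_coe.1 (Nat.lt_add_of_pos_left y.pos)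
  have h4 : ∀ y : ℕ+, y + 1 - 1 = y := fun y => PNat.add_sub
  simp only [h3, h4, lt_irrefl, if_true, if_false, tail_one, mul_one]
  rw [add_left_comm, ← ENNReal.tsum_add]
  congr 2 with y
  rw [N.tail_eq_size_add i y]
  ring

/-! ### Insertion and removal of packets -/

theorem insertAt_removeAt (q : N.State) (j : J) (l : Fin (q j).length) :
    N.insertAt (N.removeAt q j l) ⟨j, (q j).get l⟩ l = q := by
  simp [insertAt, removeAt, List.insertIdx_eraseIdx_getElem]

theorem removeAt_insertAt (R : N.State) (p : N.Located) (l : ℕ) :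
    N.removeAt (N.insertAt R p l) p.1 l = R := by
  simp [insertAt, removeAt]

theorem insertAt_self (R : N.State) (p : N.Located) (l : ℕ) :
    N.insertAt R p l p.1 = (R p.1).insertIdx l p.2 := by
  simp [insertAt]

theorem length_insertAt_self (R : N.State) (p : N.Located) {l : ℕ} (hl : l ≤ (R p.1).length) :
    (N.insertAt R p l p.1).length = (R p.1).length + 1 := by
  rw [insertAt_self, List.length_insertIdx_of_le_length hl]

theorem length_removeAt_self (q : N.State) (j : J) (l : Fin (q j).length) :
    (N.removeAt q j l j).length + 1 = (q j).length := by
  have := l.2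
  simp [removeAt, List.length_eraseIdx]
  omega

/-- States with a distinguished packet correspond, by taking that packet out, to states with
a packet that joins its queue at a given position. -/
theorem tsum_removeAt [Fintype J] (G : N.State → N.Located → ℕ → ℝ≥0∞) :
    ∑' q : N.State, ∑ j, ∑ l : Fin (q j).length, G (N.removeAt q j l) ⟨j, (q j).get l⟩ l =
      ∑' R : N.State, ∑' p : N.Located, ∑ l ∈ Finset.range ((R p.1).length + 1), G R p l := by
  classical
  -- Positions are natural numbers in the target, with value `0` beyond the end of the queue, so that
  -- no index type depends on the state.
  set H : N.State × N.Located × ℕ → ℝ≥0∞ := fun a =>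
    if a.2.2 ≤ (a.1 a.2.1.1).length then G a.1 a.2.1 a.2.2 else 0 with hH
  set e : (Σ q : N.State, Σ j, Fin (q j).length) → N.State × N.Located × ℕ := fun a =>
    (N.removeAt a.1 a.2.1 a.2.2, ⟨a.2.1, (a.1 a.2.1).get a.2.2⟩, a.2.2) with he
  have he_inj : Function.Injective e := by
    rintro ⟨q, j, l⟩ ⟨q', j', l'⟩ h
    simp only [he, Prod.mk.injEq] at h
    obtain ⟨h1, h2, h3⟩ := h
    have hj : j = j' := congrArg Sigma.fst h2
    have hq : q = q' := by
      rw [← N.insertAt_removeAt q j l, h1, h2, h3, insertAt_removeAt]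
    subst hq hj
    rw [Fin.ext h3]
  have he_range : Function.support H ⊆ Set.range e := by
    rintro ⟨R, p, l⟩ h
    have hl : l ≤ (R p.1).length := by
      by_contra hl
      exact h (by simp only [hH]; rw [if_neg hl])
    have hl' : l < (N.insertAt R p l p.1).length := by
      rw [length_insertAt_self _ _ _ hl]; omega
    refine ⟨⟨N.insertAt R p l, p.1, ⟨l, hl'⟩⟩, ?_⟩
    simp only [he, removeAt_insertAt, Prod.mk.injEq, and_true, true_and]
    refine Sigma.ext rfl (heq_of_eq ?_)
    simp only [insertAt_self, List.get_eq_getElem, List.getElem_insertIdx_self]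
  have hL : ∑' q : N.State, ∑ j, ∑ l : Fin (q j).length,
      G (N.removeAt q j l) ⟨j, (q j).get l⟩ l = ∑' a, H (e a) := by
    simp_rw [ENNReal.tsum_sigma', tsum_fintype]
    congr 1 with q
    refine Finset.sum_congr rfl fun j _ => Finset.sum_congr rfl fun l _ => ?_
    have := N.length_removeAt_self q j l
    have := l.2
    simp only [hH, he]
    rw [if_pos (by omega)]
  rw [hL, he_inj.tsum_eq he_range, ENNReal.tsum_prod']
  congr 1 with R
  rw [ENNReal.tsum_prod']
  congr 1 with p
  rw [tsum_eq_sum (s := Finset.range ((R p.1).length + 1))]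
  · exact Finset.sum_congr rfl fun l hl => if_pos (Nat.lt_succ_iff.1 (Finset.mem_range.1 hl))
  · intro l hl
    refine if_neg fun h => hl (Finset.mem_range.2 (Nat.lt_succ_iff.2 h))

/-! ### The product-form weights -/

/-- The weight of the list of packets in queue `j`, so that the product form is the product over
queues of the normalised weights. -/
def listWeight (j : J) (L : List (N.PacketClass j)) : ℝ≥0∞ :=
  (L.map N.classRate).prod * ∏ l ∈ Finset.range L.length, (N.φ j (l + 1) : ℝ≥0∞)⁻¹

theorem productForm_eq [Fintype I] [Fintype J] (q : N.State) :
    N.productForm q = ∏ j, ((N.B j)⁻¹ * N.listWeight j (q j)) := by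
  refine Finset.prod_congr rfl fun j _ => ?_
  simp_rw [div_eq_mul_inv]
  rw [Finset.prod_mul_distrib, listWeight, Finset.prod_range, ← List.prod_ofFn]
  congr 3
  conv_rhs => rw [← List.ofFn_get (q j), List.map_ofFn]
  rfl

theorem φ_coe_ne_zero (j : J) {m : ℕ} (hm : 0 < m) : (N.φ j m : ℝ≥0∞) ≠ 0 :=
  ENNReal.coe_ne_zero.2 (N.φ_pos j m hm).ne'

theorem listWeight_insertIdx (j : J) (L : List (N.PacketClass j)) (c : N.PacketClass j) {l : ℕ}
    (hl : l ≤ L.length) :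
    N.listWeight j (L.insertIdx l c) * N.φ j (L.length + 1) = N.listWeight j L * N.classRate c := by
  rw [listWeight, ((List.perm_insertIdx c L hl).map _).prod_eq,
    List.length_insertIdx_of_le_length hl, Finset.prod_range_succ, List.map_cons, List.prod_cons,
    listWeight]
  rw [mul_assoc, mul_assoc, mul_assoc (∏ l ∈ _, _), ENNReal.inv_mul_cancel (N.φ_coe_ne_zero j (Nat.succ_pos L.length))
    ENNReal.coe_ne_top]
  ring

/-- The flow of services that take the packet `p` out of position `l` of its queue, leaving state
`R`, is the weight of `R` times the rate of the class of `p`, whatever the position. -/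
theorem productForm_insertAt [Fintype I] [Fintype J] (R : N.State) (p : N.Located) {l : ℕ}
    (hl : l ≤ (R p.1).length) :
    N.productForm (N.insertAt R p l) * N.φ p.1 ((R p.1).length + 1) =
      N.productForm R * N.classRate p.2 := by
  classical
  rw [productForm_eq, productForm_eq, ← Finset.mul_prod_erase _ _ (Finset.mem_univ p.1),
    ← Finset.mul_prod_erase _ (fun j => (N.B j)⁻¹ * N.listWeight j (R j)) (Finset.mem_univ p.1),
    insertAt_self]
  have : ∏ j ∈ Finset.univ.erase p.1, ((N.B j)⁻¹ * N.listWeight j (N.insertAt R p l j)) =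
      ∏ j ∈ Finset.univ.erase p.1, ((N.B j)⁻¹ * N.listWeight j (R j)) :=
    Finset.prod_congr rfl fun j hj => by
      rw [insertAt, Function.update_of_ne (Finset.ne_of_mem_erase hj)]
  rw [this, mul_right_comm, mul_assoc (N.B p.1)⁻¹, listWeight_insertIdx _ _ _ _ hl]
  ring

theorem tsum_listWeight [Fintype I] (j : J) : ∑' L, N.listWeight j L = N.B j := by
  simp only [listWeight]
  rw [ENNReal.tsum_list N.classRate fun m => ∏ l ∈ Finset.range m, (N.φ j (l + 1) : ℝ≥0∞)⁻¹, B,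
    tsum_classRate]
  congr 1 with m
  simp_rw [div_eq_mul_inv]
  rw [Finset.prod_mul_distrib, Finset.prod_const, Nat.card_Icc, Nat.add_sub_cancel,
    Finset.range_eq_Ico, Finset.prod_Ico_add' (fun l => (N.φ j l : ℝ≥0∞)⁻¹) 0 m 1]
  rfl

theorem B_ne_zero [Fintype I] (j : J) : N.B j ≠ 0 := by
  intro h
  have := ENNReal.tsum_eq_zero.1 h 0
  simp at this

theorem tsum_productForm [Fintype I] [Fintype J] (hB : ∀ j, N.B j < ⊤) :
    ∑' q, N.productForm q = 1 := by
  simp_rw [productForm_eq]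
  rw [ENNReal.tsum_pi_prod fun j L => (N.B j)⁻¹ * N.listWeight j L]
  simp_rw [ENNReal.tsum_mul_left, tsum_listWeight]
  exact Finset.prod_eq_one fun j _ => ENNReal.inv_mul_cancel (N.B_ne_zero j) (hB j).ne

/-! ### Global balance -/

/-- The proportion of service that goes to position `l`, as a function of a natural number. -/
def serviceShare (j : J) (m l : ℕ) : ℝ≥0∞ := if h : l < m then N.γ j m ⟨l, h⟩ else 0

/-- The probability to join at position `l`, as a function of a natural number. -/
def joinShare (j : J) (m l : ℕ) : ℝ≥0∞ := if h : l < m then N.δ j m ⟨l, h⟩ else 0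

theorem sum_serviceShare (j : J) (m : ℕ) :
    ∑ l ∈ Finset.range (m + 1), N.serviceShare j (m + 1) l = 1 := by
  rw [Finset.sum_range]
  simp only [serviceShare, Fin.is_lt, dite_true, Fin.eta]
  exact_mod_cast N.γ_sum j (m + 1) (Nat.succ_pos m)

theorem joinProb_eq_sum_range (R : N.State) (p : N.Located) (q' : N.State) :
    N.joinProb R p q' = ∑ l ∈ Finset.range ((R p.1).length + 1),
      N.joinShare p.1 ((R p.1).length + 1) l *
        Set.indicator {q'} 1 (N.insertAt R p l) := by
  classical
  rw [Finset.sum_range, joinProb]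
  refine Finset.sum_congr rfl fun l _ => ?_
  simp only [joinShare, Fin.is_lt, dite_true, Fin.eta, Set.indicator, Set.mem_singleton_iff,
    eq_comm (a := q'), Pi.one_apply]
  split_ifs <;> simp

/-- The rate at which services are completed in state `q`. -/
def serviceRate [Fintype J] (q : N.State) : ℝ≥0∞ :=
  ∑ j, if (q j).length = 0 then 0 else (N.φ j (q j).length : ℝ≥0∞)

/-- The service rate of the network, whichever of `γ` and `δ` splits it among positions. -/
theorem sum_φ_mul_eq_serviceRate [Fintype J] {θ : J → (m : ℕ) → Fin m → ℝ≥0}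
    (hθ : ∀ j m, 0 < m → ∑ l, θ j m l = 1) (q : N.State) :
    ∑ j, ∑ l : Fin (q j).length, (N.φ j (q j).length : ℝ≥0∞) * θ j (q j).length l =
      N.serviceRate q := by
  refine Finset.sum_congr rfl fun j _ => ?_
  rw [← Finset.mul_sum]
  split_ifs with h
  · have : IsEmpty (Fin (q j).length) := by rw [h]; infer_instance
    simp
  · have : ∑ l, (θ j (q j).length l : ℝ≥0∞) = 1 := by
      exact_mod_cast hθ j _ (Nat.pos_of_ne_zero h)
    rw [this, mul_one]

/-- What a packet does on leaving its queue, given the rest `R` of the network: probability that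
the state becomes `q'`. -/
def settleProb (R : N.State) (o : Option N.Located) (q' : N.State) : ℝ≥0∞ :=
  o.elim (Set.indicator {q'} 1 R) fun p => N.joinProb R p q'

theorem moveProb_eq (q : N.State) (j : J) (l : Fin (q j).length) (q' : N.State) :
    N.moveProb q j l q' = N.settleProb (N.removeAt q j l) (N.next ((q j).get l)) q' := by
  classical
  rw [moveProb, settleProb]
  cases N.next ((q j).get l) with
  | none => simp [Set.indicator, eq_comm]
  | some p => rfl

/-- Summing over a state and one of its packets, with `φ_j` split among the positions by `θ`, amounts
to summing over the state left behind, the class of the packet with weight `classRate`, and its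
position. With `θ = γ` the left side describes service completions; with `θ = δ` the right side
describes packets that join a queue. -/
theorem tsum_productForm_mul_sum [Fintype I] [Fintype J] (θ : J → ℕ → ℕ → ℝ≥0∞)
    (G : N.State → N.Located → ℕ → ℝ≥0∞) :
    ∑' q, N.productForm q * ∑ j, ∑ l : Fin (q j).length,
        N.φ j (q j).length * θ j (q j).length l * G (N.removeAt q j l) ⟨j, (q j).get l⟩ l =
      ∑' R, N.productForm R * ∑' p : N.Located, N.classRate p.2 *
        ∑ l ∈ Finset.range ((R p.1).length + 1), θ p.1 ((R p.1).length + 1) l * G R p l := by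
  have h := N.tsum_removeAt fun R p l => N.productForm R * (N.classRate p.2 *
    (θ p.1 ((R p.1).length + 1) l * G R p l))
  simp_rw [← Finset.mul_sum, ENNReal.tsum_mul_left] at h
  rw [← h]
  congr 1 with q
  simp_rw [Finset.mul_sum]
  refine Finset.sum_congr rfl fun j _ => Finset.sum_congr rfl fun l _ => ?_
  have hlen := N.length_removeAt_self q j l
  have hw := N.productForm_insertAt (N.removeAt q j l) ⟨j, (q j).get l⟩ (l := l)
    (by have := l.2; simp only; omega)
  simp only [insertAt_removeAt, hlen] at hw
  simp only [hlen]
  rw [← mul_assoc (N.productForm _) (N.classRate _), ← hw]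
  ring

theorem tsum_productForm_mul_service [Fintype I] [Fintype J] (K : N.State → N.Located → ℝ≥0∞) :
    ∑' q, N.productForm q * ∑ j, ∑ l : Fin (q j).length,
        N.φ j (q j).length * N.γ j (q j).length l * K (N.removeAt q j l) ⟨j, (q j).get l⟩ =
      ∑' R, N.productForm R * ∑' p : N.Located, N.classRate p.2 * K R p := by
  have h := N.tsum_productForm_mul_sum N.serviceShare fun R p _ => K R p
  simp_rw [← Finset.sum_mul, sum_serviceShare, one_mul] at h
  simpa only [serviceShare, Fin.is_lt, dite_true, Fin.eta] using h

theorem tsum_productForm_mul_joinProb [Fintype I] [Fintype J] (q' : N.State) :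
    ∑' R, N.productForm R * ∑' p : N.Located, N.classRate p.2 * N.joinProb R p q' =
      N.productForm q' * N.serviceRate q' := by
  classical
  have h := N.tsum_productForm_mul_sum N.joinShare
    fun R p l => Set.indicator {q'} 1 (N.insertAt R p l)
  simp_rw [← joinProb_eq_sum_range] at h
  rw [← h, tsum_eq_single q']
  · simp only [insertAt_removeAt, joinShare, Fin.is_lt, dite_true, Fin.eta]
    simp [sum_φ_mul_eq_serviceRate N N.δ_sum]
  · intro q hq
    simp only [insertAt_removeAt]
    simp [hq]

theorem tsum_joinProb (R : N.State) (p : N.Located) : ∑' q', N.joinProb R p q' = 1 := by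
  classical
  simp only [joinProb]
  rw [Summable.tsum_finsetSum fun _ _ => ENNReal.summable]
  simp_rw [tsum_ite_eq]
  exact_mod_cast N.δ_sum p.1 _ (Nat.succ_pos _)

theorem tsum_settleProb (R : N.State) (o : Option N.Located) : ∑' q', N.settleProb R o q' = 1 := by
  classical
  cases o with
  | none =>
    rw [tsum_eq_single R]
    · simp [settleProb]
    · intro q' hq'
      simp [settleProb, hq'.symm]
  | some p => exact N.tsum_joinProb R p

theorem exitRate_eq [Fintype I] [Fintype J] (q : N.State) :
    JumpChain.exitRate N.rate q = ∑ i, (N.arrRate i : ℝ≥0∞) + N.serviceRate q := by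
  rw [JumpChain.exitRate]
  simp only [rate, moveProb_eq]
  rw [ENNReal.tsum_add]
  congr 1
  · rw [Summable.tsum_finsetSum fun _ _ => ENNReal.summable]
    refine Finset.sum_congr rfl fun i _ => ?_
    rw [ENNReal.tsum_comm]
    simp_rw [ENNReal.tsum_mul_left, tsum_joinProb, mul_one]
    rw [ENNReal.tsum_mul_left, PMF.tsum_coe, mul_one]
  · rw [Summable.tsum_finsetSum fun _ _ => ENNReal.summable, ← sum_φ_mul_eq_serviceRate N N.γ_sum]
    refine Finset.sum_congr rfl fun j _ => ?_
    rw [Summable.tsum_finsetSum fun _ _ => ENNReal.summable]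
    simp_rw [ENNReal.tsum_mul_left, tsum_settleProb, mul_one]

theorem exitRate_ne_top [Fintype I] [Fintype J] (q : N.State) :
    JumpChain.exitRate N.rate q ≠ ⊤ := by
  rw [exitRate_eq, serviceRate]
  refine ENNReal.add_ne_top.2 ⟨ENNReal.sum_ne_top.2 fun _ _ => ENNReal.coe_ne_top,
    ENNReal.sum_ne_top.2 fun j _ => ?_⟩
  split_ifs <;> simp

theorem productForm_balance [Fintype I] [Fintype J] (q' : N.State) :
    ∑' q, N.productForm q * N.rate q q' =
      N.productForm q' * JumpChain.exitRate N.rate q' := by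
  classical
  simp only [rate, moveProb_eq, mul_add]
  rw [ENNReal.tsum_add, N.tsum_productForm_mul_service fun R p => N.settleProb R (N.next p.2) q',
    ← ENNReal.tsum_add]
  simp_rw [← mul_add]
  have h := fun R => N.traffic_equation fun o => N.settleProb R o q'
  simp only [settleProb, Option.elim_some] at h ⊢
  simp_rw [h, mul_add]
  rw [ENNReal.tsum_add, tsum_productForm_mul_joinProb, exitRate_eq, mul_add, tsum_eq_single q']
  · simp
  · intro q hq
    simp [hq]

theorem tsum_productForm_mul_exitRate_ne_top [Fintype I] [Fintype J] (hB : ∀ j, N.B j < ⊤) :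
    ∑' q, N.productForm q * JumpChain.exitRate N.rate q ≠ ⊤ := by
  simp_rw [exitRate_eq, mul_add]
  have h := N.tsum_productForm_mul_service fun _ _ => 1
  simp only [mul_one, sum_φ_mul_eq_serviceRate N N.γ_sum] at h
  rw [ENNReal.tsum_add, h, ENNReal.tsum_mul_right, ENNReal.tsum_mul_right, tsum_productForm N hB,
    one_mul, one_mul, tsum_classRate_located]
  exact ENNReal.add_ne_top.2 ⟨ENNReal.sum_ne_top.2 fun _ _ => ENNReal.coe_ne_top,
    ENNReal.sum_ne_top.2 fun i _ => ENNReal.mul_ne_top (ENNReal.natCast_ne_top _) (N.load_ne_top i)⟩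

/-! ### Accessibility of the empty state -/

/-- The number of services that a packet of class `c` and its successors still need. -/
def classWork {j : J} (c : N.PacketClass j) : ℕ :=
  ((c.residual : ℕ) - 1) * N.len c.route + (N.len c.route - c.stage)

/-- The number of services needed to empty the network. -/
def work [Fintype J] (q : N.State) : ℕ := ∑ j, ((q j).map N.classWork).sum

theorem classWork_pos {j : J} (c : N.PacketClass j) : 0 < N.classWork c := by
  have := c.stage.2
  unfold classWork
  omega

theorem classWork_next {j : J} (c : N.PacketClass j) {p : N.Located} (h : N.next c = some p) :
    N.classWork p.2 < N.classWork c := by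
  have hk := c.stage.2
  unfold next at h
  split_ifs at h with h1 h2
  · obtain rfl := Option.some.inj h
    simp only [classWork]
    omega
  · obtain rfl := Option.some.inj h
    have h2' : 1 < (c.residual : ℕ) := h2
    obtain ⟨y, hy⟩ : ∃ y, (c.residual : ℕ) = y + 2 := ⟨(c.residual : ℕ) - 2, by omega⟩
    simp only [classWork, entry, PNat.sub_coe, h2, if_true, hy, PNat.one_coe]
    have : y + 2 - 1 - 1 = y := by omega
    rw [this, show y + 2 - 1 = y + 1 by omega, Nat.add_mul]
    omega

theorem work_insertAt [Fintype J] (R : N.State) (p : N.Located) {l : ℕ}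
    (hl : l ≤ (R p.1).length) : N.work (N.insertAt R p l) = N.work R + N.classWork p.2 := by
  classical
  rw [work, work, ← Finset.add_sum_erase _ _ (Finset.mem_univ p.1),
    ← Finset.add_sum_erase _ (fun j => ((R j).map N.classWork).sum) (Finset.mem_univ p.1),
    insertAt_self, ((List.perm_insertIdx p.2 (R p.1) hl).map _).sum_eq, List.map_cons,
    List.sum_cons]
  have : ∑ j ∈ Finset.univ.erase p.1, ((N.insertAt R p l j).map N.classWork).sum =
      ∑ j ∈ Finset.univ.erase p.1, ((R j).map N.classWork).sum :=
    Finset.sum_congr rfl fun j hj => by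
      rw [insertAt, Function.update_of_ne (Finset.ne_of_mem_erase hj)]
  rw [this]
  omega

theorem exists_pos_of_sum_eq_one {m : ℕ} {f : Fin m → ℝ≥0} (h : ∑ l, f l = 1) : ∃ l, 0 < f l := by
  by_contra! hf
  simp [fun l => le_antisymm (hf l) bot_le] at h

theorem exists_rate_pos [Fintype I] [Fintype J] {q : N.State} (hq : q ≠ fun _ => []) :
    ∃ q', 0 < N.rate q q' ∧ N.work q' < N.work q := by
  classical
  obtain ⟨j, hj⟩ := Function.ne_iff.1 hq
  have hlen : 0 < (q j).length := List.length_pos_iff.2 hj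
  obtain ⟨l, hl⟩ := exists_pos_of_sum_eq_one (N.γ_sum j _ hlen)
  have hrate : ∀ q', 0 < N.moveProb q j l q' → 0 < N.rate q q' := by
    intro q' h
    rw [rate]
    refine lt_of_lt_of_le ?_ le_add_self
    refine lt_of_lt_of_le ?_ (Finset.single_le_sum (f := fun j => ∑ l : Fin (q j).length,
      (N.φ j (q j).length : ℝ≥0∞) * N.γ j (q j).length l * N.moveProb q j l q')
      (fun _ _ => bot_le) (Finset.mem_univ j))
    refine lt_of_lt_of_le ?_ (Finset.single_le_sum (f := fun l : Fin (q j).length =>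
      (N.φ j (q j).length : ℝ≥0∞) * N.γ j (q j).length l * N.moveProb q j l q')
      (fun _ _ => bot_le) (Finset.mem_univ l))
    exact ENNReal.mul_pos (mul_ne_zero (N.φ_coe_ne_zero j hlen)
      (ENNReal.coe_ne_zero.2 hl.ne')) h.ne'
  have hwork := N.work_insertAt (N.removeAt q j l) ⟨j, (q j).get l⟩ (l := l)
    (by have := N.length_removeAt_self q j l; have := l.2; simp only; omega)
  rw [insertAt_removeAt] at hwork
  cases hn : N.next ((q j).get l) with
  | none =>
    refine ⟨N.removeAt q j l, hrate _ ?_, ?_⟩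
    · rw [moveProb_eq, hn]
      simp [settleProb]
    · have := N.classWork_pos ((q j).get l)
      simp only at hwork
      omega
  | some p =>
    obtain ⟨l', hl'⟩ := exists_pos_of_sum_eq_one
      (N.δ_sum p.1 ((N.removeAt q j l p.1).length + 1) (Nat.succ_pos _))
    refine ⟨N.insertAt (N.removeAt q j l) p l', hrate _ ?_, ?_⟩
    · rw [moveProb_eq, hn]
      simp only [settleProb, Option.elim_some, joinProb]
      refine lt_of_lt_of_le ?_ (Finset.single_le_sum (fun _ _ => bot_le) (Finset.mem_univ l'))
      rw [if_pos rfl]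
      exact ENNReal.coe_pos.2 hl'
    · rw [work_insertAt N _ _ (Nat.lt_succ_iff.1 l'.2), hwork]
      have := N.classWork_next _ hn
      simp only
      omega

theorem reflTransGen_empty [Fintype I] [Fintype J] (q : N.State) :
    Relation.ReflTransGen (fun a b => 0 < N.rate a b) q fun _ => [] := by
  induction hw : N.work q using Nat.strong_induction_on generalizing q with
  | _ w ih =>
    by_cases hq : q = fun _ => []
    · rw [hq]
    · obtain ⟨q', hpos, hlt⟩ := N.exists_rate_pos hq
      exact Relation.ReflTransGen.head hpos (ih _ (hw ▸ hlt) q' rfl)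

end MQNwS

end

theorem theorem3p2 {I J : Type*} [Fintype I] [Fintype J] (N : MQNwS I J)
    (hB : ∀ j, N.B j < ⊤) :
    JumpChain.IsStationary N.rate N.productForm ∧
      ∀ p : N.State → ℝ≥0∞, JumpChain.IsStationary N.rate p → p = N.productForm := by
  have hstat : JumpChain.IsStationary N.rate N.productForm :=
    JumpChain.isStationary_of_balance N.exitRate_ne_top N.productForm_balance
      (N.tsum_productForm hB) (N.tsum_productForm_mul_exitRate_ne_top hB)
  exact ⟨hstat, fun p hp => hp.unique hstat N.exitRate_ne_top zero_le_one
    fun q => JumpChain.trans_pos_of_reflTransGen (N.reflTransGen_empty q) one_pos⟩
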